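/- All logarithms and exponentials are to base $2$. Let $\rho$ be a density operator on $\mathcal H=\mathbb C^d$, let $\mathbf a=(a_1,\dots,a_m)$ be a POVM on $\mathcal H$ (that is, $a_j\ge 0$ and $\sum_j a_j=\mathbf 1$), and put $$\lambda_j=\operatorname{Tr}(\rho a_j),\qquad \hat\rho_j=\frac{1}{\lambda_j}\sqrt\rho\,a_j\sqrt\rho,\qquad H(\lambda)=-\sum_j\lambda_j\log\lambda_j,\qquad I(\lambda;\hat\rho)=H(\rho)-\sum_j\lambda_jH(\hat\rho_j),$$ where $H(\sigma)=-\operatorname{Tr}\sigma\log\sigma$ is the von Neumann entropy and terms with $\lambda_j=0$ are omitted. For a word $j^l=j_1\dots j_l\in[m]^l$ write $a_{j^l}=a_{j_1}\otimes\cdots\otimes a_{j_l}$. For all $m$ and all $\epsilon<1$ there is a constant $C_2=C_2(\epsilon,m)$, and for all $d$ moreover a constant $C_1=C_1(\epsilon,d,m)$, such that the following holds for all $\rho$ and $\mathbf a$ as above and all $l$, $N$, $M$. Let $\mathbf A^{(\nu)}=(A^{(\nu)}_{j^l})_{j^l\in[m]^l}$, $\nu=1,\dots,N$, be POVMs on $\mathcal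 H^{\otimes l}$ with at most $M$ nonzero operators each, let $x_\nu>0$ be weights with $\sum_\nu x_\nu=1$, and suppose that $A_{j^l}=\sum_\nu x_\nu A^{(\nu)}_{j^l}$ satisfies $$\sum_{j^l\in[m]^l}\frac12\left\|\sqrt\rho^{\otimes l}\,(A_{j^l}-a_{j^l})\,\sqrt\rho^{\otimes l}\right\|_1\le\epsilon .\tag{CM}$$ Then $$M\ge\exp\bigl(l\,I(\lambda;\hat\rho)-C_1\sqrt l\bigr)\qquad\text{and}\qquad MN\ge\exp\bigl(l\,H(\lambda)-C_2\sqrt l\bigr).$$ -/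

import Mathlib

open scoped ComplexOrder MatrixOrder

noncomputable section

namespace QMeas

/-- A state (density operator) on `ℂ^n`: a positive semidefinite matrix of trace one. -/
def IsState {n : Type*} [Fintype n] (ρ : Matrix n n ℂ) : Prop :=
  ρ.PosSemidef ∧ ρ.trace = 1

/-- A positive operator valued measure with outcome set `J`. -/
def IsPOVM {J n : Type*} [Fintype J] [Fintype n] [DecidableEq n]
    (A : J → Matrix n n ℂ) : Prop :=
  (∀ j, (A j).PosSemidef) ∧ ∑ j, A j = 1

/-- The tensor product `X₁ ⊗ ⋯ ⊗ X_l` of operators on `ℂ^n`, as an operator on `(ℂ^n)^{⊗l}`;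
the product basis of the latter is indexed by words of length `l` over `n`. -/
def tensor {n : Type*} {l : ℕ} (X : Fin l → Matrix n n ℂ) :
    Matrix (Fin l → n) (Fin l → n) ℂ :=
  Matrix.of fun s t => ∏ k, X k (s k) (t k)

/-- The trace norm `Tr |X|`, where `|X| = √(X* X)`. -/
def traceNorm {n : Type*} [Fintype n] [DecidableEq n] (X : Matrix n n ℂ) : ℝ :=
  (CFC.sqrt (X.conjTranspose * X)).trace.re

/-- The von Neumann entropy `-Tr ρ log₂ ρ`, in bits (with `0 log 0 = 0`). -/
def vonNeumannEntropy {n : Type*} [Fintype n] [DecidableEq n] (ρ : Matrix n n ℂ) : ℝ :=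
  (cfc (fun t : ℝ => -(t * Real.logb 2 t)) ρ).trace.re

/-- The Shannon entropy of a distribution, in bits (with `0 log 0 = 0`). -/
def shannonEntropy {J : Type*} [Fintype J] (p : J → ℝ) : ℝ :=
  ∑ j, -(p j * Real.logb 2 (p j))

/-- The outcome distribution `λ_j = Tr (ρ a_j)`. -/
def outcomeProb {J n : Type*} [Fintype n] (ρ : Matrix n n ℂ)
    (a : J → Matrix n n ℂ) (j : J) : ℝ :=
  (ρ * a j).trace.re

/-- The states `ρ̂_j = λ_j⁻¹ √ρ a_j √ρ`. Where `λ_j = 0`, this is the zero matrix; such `j`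
always enter with weight zero below. -/
def postState {J n : Type*} [Fintype n] [DecidableEq n] (ρ : Matrix n n ℂ)
    (a : J → Matrix n n ℂ) (j : J) : Matrix n n ℂ :=
  (outcomeProb ρ a j)⁻¹ • (CFC.sqrt ρ * a j * CFC.sqrt ρ)

/-- The quantum mutual information `I(λ; ρ̂) = H(ρ) - ∑ λ_j H(ρ̂_j)`. -/
def mutualInfo {J n : Type*} [Fintype J] [Fintype n] [DecidableEq n] (ρ : Matrix n n ℂ)
    (a : J → Matrix n n ℂ) : ℝ :=
  vonNeumannEntropy ρ - ∑ j, outcomeProb ρ a j * vonNeumannEntropy (postState ρ a j)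

/-- Condition (CM): on words `j` of length `l`, the operators `A j` approximate
`a_{j₁} ⊗ ⋯ ⊗ a_{j_l}` up to `ε`, in the sense that
`∑_j ½ ‖√ρ^{⊗l} (A j - a_{j₁} ⊗ ⋯ ⊗ a_{j_l}) √ρ^{⊗l}‖₁ ≤ ε`. -/
def CondCM {J n : Type*} [Fintype J] [Fintype n] [DecidableEq n] {l : ℕ}
    (ρ : Matrix n n ℂ) (a : J → Matrix n n ℂ)
    (A : (Fin l → J) → Matrix (Fin l → n) (Fin l → n) ℂ) (ε : ℝ) : Prop :=
  ∑ j : Fin l → J, (1 / 2 : ℝ) *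
    traceNorm (tensor (fun _ : Fin l => CFC.sqrt ρ) * (A j - tensor (fun k => a (j k))) *
      tensor (fun _ : Fin l => CFC.sqrt ρ)) ≤ ε

end QMeas

end

/-!
The proof tests condition (CM) with effects. For effects `0 ≤ Q_j ≤ 1` and Hermitian `X_j` of total
trace zero, `-∑ Tr (X_j Q_j) ≤ ∑ ½ ‖X_j‖₁` (`neg_trace_mul_le`). Hence, with `R = √ρ^{⊗l}`, the
approximating POVM satisfies `∑ Tr (R A_j R Q_j) ≥ ∑ Tr (R a_j R Q_j) - ε`
(`sum_trace_tensor_le`), and both bounds follow from a good choice of `Q`.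

For the bound on `M N`, let `Q_j` be `1` off the support of `A` and `0` on it. The support, which has
at most `M N` words, then has probability at least `1 - ε` under the product distribution `λ^l`.
As all but a small portion of `λ^l` sits on words of probability at most `2^(-l H(λ) + c √l)`, there
must be enough of these words (`converse_total`).

For the bound on `M`, let `Q_j` be the projector onto those product eigenvectors of
`ρ̂_{j₁} ⊗ ⋯ ⊗ ρ̂_{j_l}` whose eigenvalue is at least `2^(-l h - c √l)`, where `h = ∑ λ_j H(ρ̂_j)`.
Its rank is at most `2^(l h + c √l)`, and the product measurement passes this test with high
probability. Split `R = R₁ + R₂` along the eigenvectors of `ρ^{⊗l}` with eigenvalue at most, or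
more than, `2^(-l H(ρ) + c √l)`. The operator inequality `R A R ≤ 2 R₁ A R₁ + 2 R₂ A R₂` disposes
of cross terms: the atypical part contributes at most `2 Tr R₂²`, and each of the `M` nonzero
operators of a component POVM contributes at most twice the product of the rank of `Q_j` and
`‖R₁²‖` (`sum_trace_compress_le`). The result is a lower bound of order `2^(l I - 2 c √l)` on `M`
(`converse_rate`).

All three notions of typicality come from Chebyshev's inequality (`sum_prod_filter_le`) for the
logarithm of a product of probabilities. Since `t (log t)²` is bounded on `[0, 1]`, the variance is
at most a constant times the size of the alphabet, so that `c` depends on `ε` and `m`, or on `ε` and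
`d`, only.
-/

open scoped ComplexOrder MatrixOrder

namespace QMeas

open Finset Matrix

/-! ### Large deviations for words -/

lemma sum_words_succ {Ω : Type*} [Fintype Ω] {l : ℕ} (F : (Fin (l + 1) → Ω) → ℝ) :
    ∑ w, F w = ∑ a, ∑ w : Fin l → Ω, F (Fin.cons a w) := by
  rw [← (Fin.consEquiv (fun _ : Fin (l + 1) => Ω)).sum_comp, Fintype.sum_prod_type]
  rfl

lemma sum_prod_words {Ω : Type*} [Fintype Ω] {p : Ω → ℝ} (hp : ∑ a, p a = 1) (l : ℕ) :
    ∑ w : Fin l → Ω, ∏ k, p (w k) = 1 := by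
  rw [← Fintype.sum_pow, hp, one_pow]

/-- Under a product distribution, a sum of centred letter functions has mean zero and its variance
is additive. -/
lemma moments_words {Ω : Type*} [Fintype Ω] {p g : Ω → ℝ} (hp : ∑ a, p a = 1)
    (hg : ∑ a, p a * g a = 0) (l : ℕ) :
    ∑ w : Fin l → Ω, (∏ k, p (w k)) * ∑ k, g (w k) = 0 ∧
    ∑ w : Fin l → Ω, (∏ k, p (w k)) * (∑ k, g (w k)) ^ 2 = l * ∑ a, p a * g a ^ 2 := by
  induction l with
  | zero => simp
  | succ l ih =>
    obtain ⟨h1, h2⟩ := ih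
    have h0 := sum_prod_words hp l
    constructor
    · rw [sum_words_succ]
      have (a : Ω) : ∑ w : Fin l → Ω, (∏ k, p ((Fin.cons a w : Fin (l + 1) → Ω) k)) *
          ∑ k, g ((Fin.cons a w : Fin (l + 1) → Ω) k) = p a * g a := by
        simp only [Fin.prod_univ_succ, Fin.sum_univ_succ, Fin.cons_zero, Fin.cons_succ]
        calc _ = p a * g a * ∑ w : Fin l → Ω, ∏ k, p (w k) +
              p a * ∑ w : Fin l → Ω, (∏ k, p (w k)) * ∑ k, g (w k) := by
              rw [mul_sum, mul_sum, ← sum_add_distrib]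
              exact sum_congr rfl fun w _ => by ring
          _ = _ := by rw [h0, h1]; ring
      rw [sum_congr rfl fun a _ => this a, hg]
    · rw [sum_words_succ]
      have (a : Ω) : ∑ w : Fin l → Ω, (∏ k, p ((Fin.cons a w : Fin (l + 1) → Ω) k)) *
          (∑ k, g ((Fin.cons a w : Fin (l + 1) → Ω) k)) ^ 2 =
          p a * g a ^ 2 + p a * (l * ∑ a, p a * g a ^ 2) := by
        simp only [Fin.prod_univ_succ, Fin.sum_univ_succ, Fin.cons_zero, Fin.cons_succ]
        calc _ = p a * g a ^ 2 * ∑ w : Fin l → Ω, ∏ k, p (w k) +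
              2 * p a * g a * ∑ w : Fin l → Ω, (∏ k, p (w k)) * ∑ k, g (w k) +
              p a * ∑ w : Fin l → Ω, (∏ k, p (w k)) * (∑ k, g (w k)) ^ 2 := by
              rw [mul_sum, mul_sum, mul_sum, ← sum_add_distrib, ← sum_add_distrib]
              exact sum_congr rfl fun w _ => by ring
          _ = _ := by rw [h0, h1, h2]; ring
      rw [sum_congr rfl fun a _ => this a, sum_add_distrib, ← sum_mul, hp]
      push_cast; ring

/-- Chebyshev's inequality for the empirical sum of a letter function `f` along a random word. -/
lemma sum_prod_filter_le {Ω : Type*} [Fintype Ω] {p f : Ω → ℝ} (hp0 : ∀ a, 0 ≤ p a)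
    (hp : ∑ a, p a = 1) {c V : ℝ} (hc : 0 < c) (hV : ∑ a, p a * f a ^ 2 ≤ V) (l : ℕ)
    (P : (Fin l → Ω) → Prop) [DecidablePred P]
    (hP : ∀ w, P w → (∀ k, p (w k) ≠ 0) →
      c * √l < |∑ k, f (w k) - l * ∑ a, p a * f a|) :
    ∑ w with P w, ∏ k, p (w k) ≤ V / c ^ 2 := by
  set E := ∑ a, p a * f a with hE
  have hg : ∑ a, p a * (f a - E) = 0 := by
    simp only [mul_sub, sum_sub_distrib, ← sum_mul, hp]; rw [← hE]; ring
  have hvar : ∑ a, p a * (f a - E) ^ 2 ≤ V := by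
    have expand (x : ℝ) : ∑ a, p a * (f a - x) ^ 2 =
        ∑ a, p a * f a ^ 2 - 2 * x * ∑ a, p a * f a + x ^ 2 * ∑ a, p a := by
      rw [mul_sum, mul_sum, ← sum_sub_distrib, ← sum_add_distrib]
      exact sum_congr rfl fun a _ => by ring
    rw [expand, hp, ← hE]
    nlinarith [sq_nonneg E]
  have h2 := (moments_words hp hg l).2
  have hnn (w : Fin l → Ω) : 0 ≤ ∏ k, p (w k) := prod_nonneg fun k _ => hp0 _
  have hV0 : 0 ≤ V := le_trans (sum_nonneg fun a _ => mul_nonneg (hp0 a) (sq_nonneg _)) hV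
  rcases Nat.eq_zero_or_pos l with rfl | hl
  · -- the hypothesis on `P` is a strict inequality `0 < 0` on the empty word
    have : ∀ w, ¬ P w := fun w hw => by simpa using hP w hw (fun k => k.elim0)
    simp only [this, filter_false, sum_empty]; positivity
  have hl' : (0 : ℝ) < l := by exact_mod_cast hl
  have key : c ^ 2 * l * ∑ w with P w, ∏ k, p (w k) ≤ l * V := by
    calc c ^ 2 * l * ∑ w with P w, ∏ k, p (w k)
        = ∑ w with P w, (∏ k, p (w k)) * (c ^ 2 * l) := by rw [mul_comm, sum_mul]
      _ ≤ ∑ w with P w, (∏ k, p (w k)) * (∑ k, (f (w k) - E)) ^ 2 := by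
          refine sum_le_sum fun w hw => ?_
          by_cases h : ∀ k, p (w k) ≠ 0
          · refine mul_le_mul_of_nonneg_left ?_ (hnn w)
            have h3 := hP w (mem_filter.1 hw).2 h
            have h4 : ∑ k, (f (w k) - E) = ∑ k, f (w k) - l * E := by
              simp [sum_sub_distrib]
            rw [h4, ← sq_abs (_ - _)]
            calc c ^ 2 * l = (c * √l) ^ 2 := by rw [mul_pow, Real.sq_sqrt hl'.le]
              _ ≤ _ := by gcongr
          · push Not at h
            obtain ⟨k, hk⟩ := h
            rw [prod_eq_zero (mem_univ k) hk]; simp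
      _ ≤ ∑ w : Fin l → Ω, (∏ k, p (w k)) * (∑ k, (f (w k) - E)) ^ 2 :=
          sum_le_sum_of_subset_of_nonneg (filter_subset _ _)
            fun w _ _ => mul_nonneg (hnn w) (sq_nonneg _)
      _ ≤ l * V := by rw [h2]; gcongr
  rw [le_div_iff₀ (by positivity)]
  nlinarith

lemma logb_prod_words {Ω : Type*} {q : Ω → ℝ} {l : ℕ} {w : Fin l → Ω} (h : ∀ k, 0 < q (w k)) :
    Real.logb 2 (∏ k, q (w k)) = - ∑ k, -Real.logb 2 (q (w k)) := by
  rw [Real.logb_prod _ _ fun k _ => (h k).ne', sum_neg_distrib, neg_neg]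

/-- A random word is unlikely to have a probability that exceeds the typical one by much. -/
lemma sum_prod_large_le {Ω : Type*} [Fintype Ω] {p q : Ω → ℝ} (hp0 : ∀ a, 0 ≤ p a)
    (hp : ∑ a, p a = 1) (hq : ∀ a, p a ≠ 0 → 0 < q a) {c V : ℝ} (hc : 0 < c)
    (hV : ∑ a, p a * Real.logb 2 (q a) ^ 2 ≤ V) (l : ℕ) :
    ∑ w : Fin l → Ω with
      (2 : ℝ) ^ (-(l * ∑ a, p a * -Real.logb 2 (q a)) + c * √l) < ∏ k, q (w k),
      ∏ k, p (w k) ≤ V / c ^ 2 := by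
  refine sum_prod_filter_le (f := fun a => -Real.logb 2 (q a)) hp0 hp hc (by simpa using hV) l _ ?_
  intro w hw h
  have h1 := Real.logb_lt_logb one_lt_two (by positivity) hw
  rw [Real.logb_rpow two_pos (by norm_num), logb_prod_words fun k => hq _ (h k)] at h1
  rw [lt_abs]; right; linarith

/-- A random word is unlikely to have a probability far below the typical one. -/
lemma sum_prod_small_le {Ω : Type*} [Fintype Ω] {p q : Ω → ℝ} (hp0 : ∀ a, 0 ≤ p a)
    (hp : ∑ a, p a = 1) (hq : ∀ a, p a ≠ 0 → 0 < q a) {c V : ℝ} (hc : 0 < c)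
    (hV : ∑ a, p a * Real.logb 2 (q a) ^ 2 ≤ V) (l : ℕ) :
    ∑ w : Fin l → Ω with
      ∏ k, q (w k) < (2 : ℝ) ^ (-(l * ∑ a, p a * -Real.logb 2 (q a)) - c * √l),
      ∏ k, p (w k) ≤ V / c ^ 2 := by
  refine sum_prod_filter_le (f := fun a => -Real.logb 2 (q a)) hp0 hp hc (by simpa using hV) l _ ?_
  intro w hw h
  have h1 := Real.logb_lt_logb one_lt_two (prod_pos fun k _ => hq _ (h k)) hw
  rw [Real.logb_rpow two_pos (by norm_num), logb_prod_words fun k => hq _ (h k)] at h1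
  rw [lt_abs]; left; linarith

lemma mul_logb_sq_le {t : ℝ} (h0 : 0 ≤ t) (h1 : t ≤ 1) :
    t * Real.logb 2 t ^ 2 ≤ 4 / Real.log 2 ^ 2 := by
  rcases h0.eq_or_lt with rfl | h0
  · simp; positivity
  have h := Real.abs_log_mul_self_lt (√t) (by positivity) (by simpa using h1)
  rw [Real.log_sqrt h0.le] at h
  have h2 : (Real.log t / 2 * √t) ^ 2 ≤ 1 := by
    rw [← sq_abs]; exact pow_le_one₀ (abs_nonneg _) h.le
  rw [mul_pow, Real.sq_sqrt h0.le] at h2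
  rw [Real.logb, div_pow, ← mul_div_assoc]
  gcongr
  linarith

lemma sum_mul_logb_sq_le {ι : Type*} [Fintype ι] {p : ι → ℝ} (hp0 : ∀ i, 0 ≤ p i)
    (hp : ∑ i, p i ≤ 1) :
    ∑ i, p i * Real.logb 2 (p i) ^ 2 ≤ Fintype.card ι * (4 / Real.log 2 ^ 2) := by
  calc _ ≤ ∑ _i : ι, 4 / Real.log 2 ^ 2 := sum_le_sum fun i _ => mul_logb_sq_le (hp0 i)
        ((single_le_sum (fun j _ => hp0 j) (mem_univ i)).trans hp)
    _ = _ := by simp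

/-- The constant factor `b` is absorbed into the `√l` term of the exponent. At `l = 0`, where there
is no such term, it is used that `n` is a positive integer. -/
lemma rpow_le_of_mul_rpow_le {b h c : ℝ} (hb : 0 < b) {l n : ℕ}
    (H : b * (2 : ℝ) ^ (l * h - c * √l) ≤ n) :
    (2 : ℝ) ^ (l * h - (c + |Real.logb 2 b|) * √l) ≤ n := by
  rcases Nat.eq_zero_or_pos l with rfl | hl
  · have hn : (0 : ℝ) < n := lt_of_lt_of_le (by positivity) H
    have : 1 ≤ n := by exact_mod_cast hn
    simpa using this
  · refine le_trans ?_ H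
    nth_rw 2 [← Real.rpow_logb two_pos (by norm_num) hb]
    rw [← Real.rpow_add two_pos]
    refine Real.rpow_le_rpow_of_exponent_le one_le_two ?_
    have h1 : 1 ≤ √(l : ℝ) := by rw [Real.one_le_sqrt]; exact_mod_cast hl
    nlinarith [neg_abs_le (Real.logb 2 b), abs_nonneg (Real.logb 2 b)]

/-! ### Traces of products of positive operators -/

section Trace
variable {n : Type*} [Fintype n] [DecidableEq n]

lemma trace_mul_nonneg {P Q : Matrix n n ℂ} (hP : P.PosSemidef) (hQ : Q.PosSemidef) :
    0 ≤ (P * Q).trace.re := by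
  have hs : (CFC.sqrt P).PosSemidef := (CFC.sqrt_nonneg P).posSemidef
  have h : (P * Q).trace = (CFC.sqrt P * Q * (CFC.sqrt P)ᴴ).trace := by
    rw [hs.isHermitian.eq, Matrix.trace_mul_comm (_ * _), ← mul_assoc,
      CFC.sqrt_mul_sqrt_self P hP.nonneg]
  rw [h]
  exact (Complex.nonneg_iff.1 (hQ.mul_mul_conjTranspose_same _).trace_nonneg).1

lemma trace_mul_le_trace_mul {P Q Q' : Matrix n n ℂ} (hP : P.PosSemidef) (hQ : Q ≤ Q') :
    (P * Q).trace.re ≤ (P * Q').trace.re := by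
  have := trace_mul_nonneg hP (Matrix.le_iff.1 hQ)
  rw [mul_sub, Matrix.trace_sub, Complex.sub_re] at this
  linarith

lemma eq_zero_of_trace_eq_zero {P : Matrix n n ℂ} (hP : P.PosSemidef) (h : P.trace.re = 0) :
    P = 0 := by
  have hs : (CFC.sqrt P).PosSemidef := (CFC.sqrt_nonneg P).posSemidef
  have hP' : P = (CFC.sqrt P)ᴴ * CFC.sqrt P := by
    rw [hs.isHermitian.eq, CFC.sqrt_mul_sqrt_self P hP.nonneg]
  have h0 : P.trace = 0 :=
    Complex.ext h (Complex.nonneg_iff.1 hP.trace_nonneg).2.symm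
  rw [hP', Matrix.trace_conjTranspose_mul_self_eq_zero_iff] at h0
  rw [hP', h0, mul_zero]

/-- Testing a Hermitian `X` against an effect `0 ≤ Q ≤ 1` yields at least minus the trace of the
negative part of `X`. -/
lemma neg_trace_mul_le {X Q : Matrix n n ℂ} (hX : X.IsHermitian) (hQ0 : 0 ≤ Q) (hQ1 : Q ≤ 1) :
    -(X * Q).trace.re ≤ 1 / 2 * traceNorm X - 1 / 2 * X.trace.re := by
  have hsa : IsSelfAdjoint X := hX
  have h1 : X⁺ - X⁻ = X := CFC.posPart_sub_negPart X hsa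
  have h2 : X⁺ + X⁻ = CFC.sqrt (Xᴴ * X) := CFC.posPart_add_negPart X hsa
  have hp : (X⁺).PosSemidef := (CFC.posPart_nonneg X).posSemidef
  have hm : (X⁻).PosSemidef := (CFC.negPart_nonneg X).posSemidef
  have h3 := trace_mul_nonneg hp hQ0.posSemidef
  have h4 := trace_mul_le_trace_mul hm hQ1
  have h5 : traceNorm X = (X⁺).trace.re + (X⁻).trace.re := by
    rw [traceNorm, ← h2, Matrix.trace_add, Complex.add_re]
  have h6 : X.trace.re = (X⁺).trace.re - (X⁻).trace.re := by
    rw [← Complex.sub_re, ← Matrix.trace_sub, h1]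
  have h7 : (X * Q).trace.re = (X⁺ * Q).trace.re - (X⁻ * Q).trace.re := by
    rw [← Complex.sub_re, ← Matrix.trace_sub, ← sub_mul, h1]
  rw [mul_one] at h4
  linarith

/-- If only `M` of the operators of a POVM are nonzero, its compressions by an operator
`R₁ + R₂`, with `R₁ ^ 2 ≤ τ` and `R₂` of small Hilbert-Schmidt norm, cannot be detected well by
effects of trace at most `K`. -/
lemma sum_trace_compress_le {J : Type*} [Fintype J] {A Q : J → Matrix n n ℂ}
    {R₁ R₂ : Matrix n n ℂ} {τ K : ℝ} {M : ℕ}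
    (hA : IsPOVM A) (hM : {j | A j ≠ 0}.ncard ≤ M) (h1 : R₁.IsHermitian) (h2 : R₂.IsHermitian)
    (hτ : R₁ * R₁ ≤ τ • (1 : Matrix n n ℂ)) (hτ0 : 0 ≤ τ) (hK0 : 0 ≤ K)
    (hQ0 : ∀ j, 0 ≤ Q j) (hQ1 : ∀ j, Q j ≤ 1) (hK : ∀ j, (Q j).trace.re ≤ K) :
    ∑ j, ((R₁ + R₂) * A j * (R₁ + R₂) * Q j).trace.re ≤
      2 * (M * (τ * K)) + 2 * (R₂ * R₂).trace.re := by
  classical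
  have hA1 (j) : A j ≤ 1 := by
    rw [← hA.2]
    exact single_le_sum (f := A) (fun i _ => (hA.1 i).nonneg) (mem_univ j)
  have conj_psd {R P : Matrix n n ℂ} (hR : R.IsHermitian) (hP : P.PosSemidef) :
      (R * P * R).PosSemidef := by
    simpa [hR.eq] using hP.mul_mul_conjTranspose_same R
  -- `R A R ≤ 2 R₁ A R₁ + 2 R₂ A R₂`, the difference being `(R₁ - R₂) A (R₁ - R₂)`
  have split (j) : ((R₁ + R₂) * A j * (R₁ + R₂) * Q j).trace.re ≤
      2 * (R₁ * A j * R₁ * Q j).trace.re + 2 * (R₂ * A j * R₂ * Q j).trace.re := by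
    have h := trace_mul_nonneg (conj_psd (h1.sub h2) (hA.1 j)) (hQ0 j).posSemidef
    have e : (R₁ + R₂) * A j * (R₁ + R₂) * Q j + (R₁ - R₂) * A j * (R₁ - R₂) * Q j =
        (R₁ * A j * R₁ * Q j + R₁ * A j * R₁ * Q j) +
        (R₂ * A j * R₂ * Q j + R₂ * A j * R₂ * Q j) := by noncomm_ring
    have e' := congrArg (fun X => (Matrix.trace X).re) e
    simp only [Matrix.trace_add, Complex.add_re] at e'
    linarith
  have first (j) : (R₁ * A j * R₁ * Q j).trace.re ≤ if A j ≠ 0 then τ * K else 0 := by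
    split_ifs with hj
    · calc (R₁ * A j * R₁ * Q j).trace.re ≤ (R₁ * R₁ * Q j).trace.re := by
            have h := trace_mul_nonneg (conj_psd h1 (Matrix.le_iff.1 (hA1 j))) (hQ0 j).posSemidef
            rw [mul_sub, sub_mul, sub_mul, Matrix.trace_sub, Complex.sub_re, mul_one] at h
            linarith
        _ ≤ (τ • (1 : Matrix n n ℂ) * Q j).trace.re := by
            have h := trace_mul_le_trace_mul (hQ0 j).posSemidef hτ
            rwa [Matrix.trace_mul_comm, Matrix.trace_mul_comm (Q j)] at h
        _ = τ * (Q j).trace.re := by simp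
        _ ≤ τ * K := by gcongr; exact hK j
    · simp only [ne_eq, not_not] at hj
      simp [hj]
  have second : ∑ j, (R₂ * A j * R₂ * Q j).trace.re ≤ (R₂ * R₂).trace.re := by
    calc _ ≤ ∑ j, (R₂ * A j * R₂).trace.re := sum_le_sum fun j _ => by
            simpa using trace_mul_le_trace_mul (conj_psd h2 (hA.1 j)) (hQ1 j)
      _ = (R₂ * (∑ j, A j) * R₂).trace.re := by
            rw [mul_sum, sum_mul, Matrix.trace_sum, Complex.re_sum]
      _ = _ := by rw [hA.2, mul_one]
  have count : ∑ j, (if A j ≠ 0 then τ * K else 0) ≤ M * (τ * K) := by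
    rw [← sum_filter, sum_const, nsmul_eq_mul]
    gcongr
    rw [Set.ncard_eq_toFinset_card'] at hM
    refine le_trans (le_of_eq ?_) hM
    congr 1; ext; simp
  calc _ ≤ ∑ j, (2 * (R₁ * A j * R₁ * Q j).trace.re + 2 * (R₂ * A j * R₂ * Q j).trace.re) :=
        sum_le_sum fun j _ => split j
    _ = 2 * ∑ j, (R₁ * A j * R₁ * Q j).trace.re + 2 * ∑ j, (R₂ * A j * R₂ * Q j).trace.re := by
        rw [sum_add_distrib, mul_sum, mul_sum]
    _ ≤ _ := by
        have := sum_le_sum fun j (_ : j ∈ univ) => first j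
        linarith

end Trace

/-! ### Unitary diagonalizations -/

/-- The operator `U diag(p) U*`, for a real vector `p`. -/
noncomputable def conjDiag {n : Type*} [Fintype n] [DecidableEq n] (U : Matrix n n ℂ) (p : n → ℝ) :
    Matrix n n ℂ :=
  U * diagonal (fun i => (p i : ℂ)) * Uᴴ

section ConjDiag
variable {n : Type*} [Fintype n] [DecidableEq n] {U : Matrix n n ℂ}

lemma conjDiag_isHermitian (U : Matrix n n ℂ) (p : n → ℝ) : (conjDiag U p).IsHermitian := by
  refine isHermitian_mul_mul_conjTranspose U (isHermitian_diagonal_of_self_adjoint _ ?_)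
  ext i; simp

lemma conjDiag_nonneg (U : Matrix n n ℂ) {p : n → ℝ} (hp : ∀ i, 0 ≤ p i) : 0 ≤ conjDiag U p := by
  refine (PosSemidef.mul_mul_conjTranspose_same (PosSemidef.diagonal ?_) U).nonneg
  intro i; simpa using hp i

lemma conjDiag_add (U : Matrix n n ℂ) (p q : n → ℝ) :
    conjDiag U p + conjDiag U q = conjDiag U (fun i => p i + q i) := by
  simp only [conjDiag, ← add_mul, ← mul_add, diagonal_add]
  push_cast; rfl

lemma smul_conjDiag (U : Matrix n n ℂ) (r : ℝ) (p : n → ℝ) :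
    r • conjDiag U p = conjDiag U (fun i => r * p i) := by
  have : diagonal (fun i => ((r * p i : ℝ) : ℂ)) = r • diagonal (fun i => (p i : ℂ)) := by
    ext i j; by_cases h : i = j <;> simp [h]
  simp only [conjDiag, this, mul_smul_comm, smul_mul_assoc]

lemma conjDiag_mul (hU : Uᴴ * U = 1) (p q : n → ℝ) :
    conjDiag U p * conjDiag U q = conjDiag U (fun i => p i * q i) := by
  have : conjDiag U p * conjDiag U q =
      U * diagonal (fun i => (p i : ℂ)) * (Uᴴ * U) * diagonal (fun i => (q i : ℂ)) * Uᴴ := by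
    simp only [conjDiag, mul_assoc]
  rw [this, hU, mul_one, mul_assoc U, diagonal_mul_diagonal]
  push_cast [conjDiag]; rfl

lemma conjDiag_one (hU : U * Uᴴ = 1) : conjDiag U (fun _ => 1) = 1 := by
  simp [conjDiag, hU]

lemma trace_conjDiag (hU : Uᴴ * U = 1) (p : n → ℝ) : (conjDiag U p).trace.re = ∑ i, p i := by
  rw [conjDiag, mul_assoc, Matrix.trace_mul_comm, mul_assoc, hU, mul_one, trace_diagonal,
    Complex.re_sum]
  simp

lemma conjDiag_mono (U : Matrix n n ℂ) {p q : n → ℝ} (h : ∀ i, p i ≤ q i) :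
    conjDiag U p ≤ conjDiag U q := by
  have e : conjDiag U q = conjDiag U p + conjDiag U (fun i => q i - p i) := by
    rw [conjDiag_add]; simp
  rw [e]
  exact le_add_of_nonneg_right (conjDiag_nonneg U fun i => sub_nonneg.2 (h i))

/-- The spectral theorem for a positive operator, in the form needed here. -/
lemma exists_eq_conjDiag {P : Matrix n n ℂ} (hP : P.PosSemidef) :
    ∃ (U : Matrix n n ℂ) (p : n → ℝ), Uᴴ * U = 1 ∧ U * Uᴴ = 1 ∧ (∀ i, 0 ≤ p i) ∧
      P = conjDiag U p ∧ CFC.sqrt P = conjDiag U (fun i => √(p i)) ∧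
      vonNeumannEntropy P = ∑ i, p i * -Real.logb 2 (p i) := by
  have hH := hP.isHermitian
  have hU1 : (hH.eigenvectorUnitary : Matrix n n ℂ)ᴴ * hH.eigenvectorUnitary = 1 :=
    Unitary.coe_star_mul_self _
  have hU2 : (hH.eigenvectorUnitary : Matrix n n ℂ) * (hH.eigenvectorUnitary : Matrix n n ℂ)ᴴ = 1 :=
    Unitary.coe_mul_star_self _
  have hp := hP.eigenvalues_nonneg
  have hPd : P = conjDiag (hH.eigenvectorUnitary : Matrix n n ℂ) hH.eigenvalues := by
    conv_lhs => rw [hH.spectral_theorem]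
    rfl
  refine ⟨hH.eigenvectorUnitary, hH.eigenvalues, hU1, hU2, hp, hPd, ?_, ?_⟩
  · refine CFC.sqrt_unique ?_ (conjDiag_nonneg _ fun i => Real.sqrt_nonneg _)
    rw [conjDiag_mul hU1]
    simp only [Real.mul_self_sqrt (hp _)]
    exact hPd.symm
  · rw [vonNeumannEntropy, hH.cfc_eq]
    have : hH.cfc (fun t : ℝ => -(t * Real.logb 2 t)) =
        conjDiag (hH.eigenvectorUnitary : Matrix n n ℂ)
          (fun i => -(hH.eigenvalues i * Real.logb 2 (hH.eigenvalues i))) := rfl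
    rw [this, trace_conjDiag hU1]
    simp

end ConjDiag

/-! ### Tensor products -/

section Tensor

lemma tensor_mul {n : Type*} [Fintype n] {l : ℕ} (X Y : Fin l → Matrix n n ℂ) :
    tensor X * tensor Y = tensor (fun k => X k * Y k) := by
  ext s t
  simp only [tensor, mul_apply, of_apply, ← prod_mul_distrib]
  rw [prod_univ_sum, Fintype.piFinset_univ]

lemma conjTranspose_tensor {n : Type*} {l : ℕ} (X : Fin l → Matrix n n ℂ) :
    (tensor X)ᴴ = tensor (fun k => (X k)ᴴ) := by
  ext s t
  simp [tensor, conjTranspose_apply]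

lemma tensor_diagonal {n : Type*} [DecidableEq n] {l : ℕ} (p : Fin l → n → ℂ) :
    tensor (fun k => diagonal (p k)) = diagonal (fun s : Fin l → n => ∏ k, p k (s k)) := by
  ext s t
  by_cases h : s = t
  · subst h; simp [tensor]
  · obtain ⟨k, hk⟩ := Function.ne_iff.1 h
    rw [diagonal_apply_ne _ h]
    exact prod_eq_zero (mem_univ k) (diagonal_apply_ne _ hk)

lemma sum_tensor {J n : Type*} [Fintype J] {l : ℕ} (a : J → Matrix n n ℂ) :
    ∑ j : Fin l → J, tensor (fun k => a (j k)) = tensor (fun _ => ∑ i, a i) := by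
  ext s t
  simp only [tensor, of_apply, Matrix.sum_apply]
  rw [prod_univ_sum, Fintype.piFinset_univ]

lemma tensor_one {n : Type*} [DecidableEq n] {l : ℕ} : tensor (fun _ : Fin l => (1 : Matrix n n ℂ)) = 1 := by
  simpa using tensor_diagonal (fun (_ : Fin l) (_ : n) => (1 : ℂ))

variable {n : Type*} [Fintype n] [DecidableEq n] {l : ℕ}

lemma tensor_conjDiag (U : Fin l → Matrix n n ℂ) (p : Fin l → n → ℝ) :
    tensor (fun k => conjDiag (U k) (p k)) =
      conjDiag (tensor U) (fun s => ∏ k, p k (s k)) := by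
  simp only [conjDiag, ← tensor_mul, tensor_diagonal, conjTranspose_tensor, Complex.ofReal_prod]

lemma tensor_conjTranspose_mul {U : Fin l → Matrix n n ℂ} (hU : ∀ k, (U k)ᴴ * U k = 1) :
    (tensor U)ᴴ * tensor U = 1 := by
  rw [conjTranspose_tensor, tensor_mul]; simp only [hU, tensor_one]

lemma tensor_mul_conjTranspose {U : Fin l → Matrix n n ℂ} (hU : ∀ k, U k * (U k)ᴴ = 1) :
    tensor U * (tensor U)ᴴ = 1 := by
  rw [conjTranspose_tensor, tensor_mul]; simp only [hU, tensor_one]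

end Tensor

/-! ### The states after a measurement -/

section Converse
variable {J n : Type*} [Fintype J] [Fintype n] [DecidableEq n]
  {ρ : Matrix n n ℂ} {a : J → Matrix n n ℂ}

lemma outcomeProb_nonneg (hρ : IsState ρ) (ha : IsPOVM a) (j : J) : 0 ≤ outcomeProb ρ a j :=
  trace_mul_nonneg hρ.1 (ha.1 j)

lemma sum_outcomeProb (hρ : IsState ρ) (ha : IsPOVM a) : ∑ j, outcomeProb ρ a j = 1 := by
  simp only [outcomeProb, ← Complex.re_sum, ← Matrix.trace_sum, ← mul_sum, ha.2, mul_one, hρ.2,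
    Complex.one_re]

lemma sqrt_isHermitian (ρ : Matrix n n ℂ) : (CFC.sqrt ρ).IsHermitian :=
  (CFC.sqrt_nonneg ρ).posSemidef.isHermitian

lemma trace_sqrt_mul_sqrt {J : Type*} {a : J → Matrix n n ℂ} (hρ : IsState ρ) (j : J) :
    (CFC.sqrt ρ * a j * CFC.sqrt ρ).trace.re = outcomeProb ρ a j := by
  rw [Matrix.trace_mul_comm, ← mul_assoc, CFC.sqrt_mul_sqrt_self ρ hρ.1.nonneg, outcomeProb]

lemma sqrt_mul_sqrt_posSemidef (ha : IsPOVM a) (j : J) :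
    (CFC.sqrt ρ * a j * CFC.sqrt ρ).PosSemidef := by
  simpa [(sqrt_isHermitian ρ).eq] using (ha.1 j).mul_mul_conjTranspose_same (CFC.sqrt ρ)

/-- Spectral decomposition of the unnormalized state `λ_j ρ̂_j = √ρ a_j √ρ`. Where `λ_j = 0`, the
eigenvalues `p` of the junk state `ρ̂_j = 0` sum to zero instead of one. -/
lemma exists_postState_eq (hρ : IsState ρ) (ha : IsPOVM a) (j : J) :
    ∃ (V : Matrix n n ℂ) (p : n → ℝ), Vᴴ * V = 1 ∧ V * Vᴴ = 1 ∧ (∀ i, 0 ≤ p i) ∧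
      ∑ i, p i ≤ 1 ∧ ∑ i, outcomeProb ρ a j * p i = outcomeProb ρ a j ∧
      CFC.sqrt ρ * a j * CFC.sqrt ρ = conjDiag V (fun i => outcomeProb ρ a j * p i) ∧
      vonNeumannEntropy (postState ρ a j) = ∑ i, p i * -Real.logb 2 (p i) := by
  have hl := outcomeProb_nonneg hρ ha j
  have hpsd := sqrt_mul_sqrt_posSemidef (ρ := ρ) ha j
  have htr := trace_sqrt_mul_sqrt (a := a) hρ j
  have hP : (postState ρ a j).PosSemidef := hpsd.smul (inv_nonneg.2 hl)
  obtain ⟨V, p, hV, hV', hp, hd, -, hent⟩ := exists_eq_conjDiag hP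
  have hs : outcomeProb ρ a j • postState ρ a j = CFC.sqrt ρ * a j * CFC.sqrt ρ := by
    by_cases h0 : outcomeProb ρ a j = 0
    · rw [eq_zero_of_trace_eq_zero hpsd (htr.trans h0), h0, zero_smul]
    · rw [postState, smul_inv_smul₀ h0]
  have htr' : ∑ i, p i = (outcomeProb ρ a j)⁻¹ * outcomeProb ρ a j := by
    rw [← trace_conjDiag hV, ← hd, postState, Matrix.trace_smul, Complex.smul_re, htr, smul_eq_mul]
  refine ⟨V, p, hV, hV', hp, ?_, ?_, ?_, hent⟩
  · rw [htr']; exact inv_mul_le_one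
  · rw [← mul_sum, htr', ← mul_assoc, mul_inv_mul_cancel]
  · rw [← hs, ← smul_conjDiag, ← hd]

/-! ### The two converse estimates -/

/-- The operational content of condition (CM): no family of effects distinguishes the subnormalized
post-measurement states of `A` from those of the product measurement by more than `ε`. -/
lemma sum_trace_tensor_le (ha : IsPOVM a) {l : ℕ} {ε : ℝ}
    {A Q : (Fin l → J) → Matrix (Fin l → n) (Fin l → n) ℂ}
    (hA : IsPOVM A) (hCM : CondCM ρ a A ε) (hQ0 : ∀ j, 0 ≤ Q j) (hQ1 : ∀ j, Q j ≤ 1) :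
    ∑ j, (tensor (fun k => CFC.sqrt ρ * a (j k) * CFC.sqrt ρ) * Q j).trace.re ≤
      ∑ j, (tensor (fun _ : Fin l => CFC.sqrt ρ) * A j * tensor (fun _ : Fin l => CFC.sqrt ρ) *
        Q j).trace.re + ε := by
  set R := tensor (fun _ : Fin l => CFC.sqrt ρ) with hRdef
  have hR : R.IsHermitian := by
    rw [Matrix.IsHermitian, hRdef, conjTranspose_tensor]; simp only [(sqrt_isHermitian ρ).eq]
  have hT (j : Fin l → J) : (tensor (fun k => a (j k))).IsHermitian := by
    rw [Matrix.IsHermitian, conjTranspose_tensor]; simp only [(ha.1 _).isHermitian.eq]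
  have hX (j) : (R * (A j - tensor (fun k => a (j k))) * R).IsHermitian := by
    have := isHermitian_mul_mul_conjTranspose R ((hA.1 j).isHermitian.sub (hT j))
    rwa [hR.eq] at this
  have hsum : ∑ j, (R * (A j - tensor (fun k => a (j k))) * R).trace.re = 0 := by
    rw [← Complex.re_sum, ← Matrix.trace_sum, ← sum_mul, ← mul_sum, sum_sub_distrib, hA.2,
      sum_tensor, ha.2, tensor_one]
    simp
  have hterm (j) : (tensor (fun k => CFC.sqrt ρ * a (j k) * CFC.sqrt ρ) * Q j).trace.re =
      (R * A j * R * Q j).trace.re +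
        -(R * (A j - tensor (fun k => a (j k))) * R * Q j).trace.re := by
    have : tensor (fun k => CFC.sqrt ρ * a (j k) * CFC.sqrt ρ) =
        R * tensor (fun k => a (j k)) * R := by rw [tensor_mul, tensor_mul]
    rw [this, mul_sub, sub_mul, sub_mul, Matrix.trace_sub, Complex.sub_re]
    ring
  rw [sum_congr rfl fun j _ => hterm j, sum_add_distrib]
  gcongr
  calc _ ≤ ∑ j, (1 / 2 * traceNorm (R * (A j - tensor (fun k => a (j k))) * R) -
          1 / 2 * (R * (A j - tensor (fun k => a (j k))) * R).trace.re) :=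
        sum_le_sum fun j _ => neg_trace_mul_le (hX j) (hQ0 j) (hQ1 j)
    _ ≤ ε := by rw [sum_sub_distrib, ← mul_sum univ (fun j => Complex.re _), hsum, mul_zero,
          sub_zero]; exact hCM

lemma isPOVM_convex {K n ι : Type*} [Fintype K] [Fintype n] [DecidableEq n] [Fintype ι]
    {x : ι → ℝ} {A : ι → K → Matrix n n ℂ} (hx : ∀ ν, 0 < x ν) (hx1 : ∑ ν, x ν = 1)
    (hA : ∀ ν, IsPOVM (A ν)) : IsPOVM (fun j => ∑ ν, x ν • A ν j) := by
  refine ⟨fun j => posSemidef_sum _ fun ν _ => ((hA ν).1 j).smul (hx ν).le, ?_⟩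
  rw [sum_comm]
  simp only [← smul_sum, (hA _).2, ← sum_smul, hx1, one_smul]

/-- The support of the approximating POVM carries probability at least `1 - ε` under the product
distribution, most of which is spread over words of small probability. -/
lemma converse_total (hρ : IsState ρ) (ha : IsPOVM a) {l N M : ℕ} {ε c : ℝ} {x : Fin N → ℝ}
    {A : Fin N → (Fin l → J) → Matrix (Fin l → n) (Fin l → n) ℂ}
    (hx : ∀ ν, 0 < x ν) (hx1 : ∑ ν, x ν = 1) (hA : ∀ ν, IsPOVM (A ν))
    (hM : ∀ ν, {j | A ν j ≠ 0}.ncard ≤ M) (hCM : CondCM ρ a (fun j => ∑ ν, x ν • A ν j) ε)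
    (hc : 0 < c) :
    1 - ε - Fintype.card J * (4 / Real.log 2 ^ 2) / c ^ 2 ≤
      M * N * (2 : ℝ) ^ (-(l * shannonEntropy (outcomeProb ρ a)) + c * √l) := by
  classical
  choose V p hV _ _ _ hpl hd _ using exists_postState_eq hρ ha
  set τ := (2 : ℝ) ^ (-(l * shannonEntropy (outcomeProb ρ a)) + c * √l) with hτ
  set W : (Fin l → J) → ℝ := fun j => ∏ k, outcomeProb ρ a (j k) with hW
  set S : Finset (Fin l → J) := univ.biUnion fun ν => univ.filter fun j => A ν j ≠ 0 with hS
  have hlam0 := outcomeProb_nonneg hρ ha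
  have hlam1 := sum_outcomeProb hρ ha
  have hcard : (S.card : ℝ) ≤ M * N := by
    have : S.card ≤ (univ : Finset (Fin N)).card * M := by
      refine card_biUnion_le_card_mul _ _ _ fun ν _ => ?_
      have := hM ν
      rw [Set.ncard_eq_toFinset_card'] at this
      refine le_trans (le_of_eq ?_) this
      congr 1; ext; simp
    rw [card_univ, Fintype.card_fin, mul_comm] at this
    exact_mod_cast this
  have htrace (j : Fin l → J) :
      (tensor (fun k => CFC.sqrt ρ * a (j k) * CFC.sqrt ρ)).trace.re = W j := by
    simp only [hd]
    rw [tensor_conjDiag, trace_conjDiag (tensor_conjTranspose_mul fun k => hV (j k)),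
      ← Fintype.piFinset_univ,
      ← prod_univ_sum (fun _ => univ) (fun k i => outcomeProb ρ a (j k) * p (j k) i)]
    simp only [hpl, hW]
  -- the effects detect the words outside the support
  have htest := sum_trace_tensor_le ha (isPOVM_convex hx hx1 hA) hCM
    (Q := fun j => if j ∈ S then 0 else 1)
    (fun j => by split_ifs; exacts [le_rfl, zero_le_one])
    (fun j => by split_ifs; exacts [zero_le_one, le_rfl])
  have hzero (j) : j ∉ S → ∑ ν, x ν • A ν j = 0 := fun hj =>
    sum_eq_zero fun ν _ => by
      have : A ν j = 0 := by
        by_contra h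
        exact hj (mem_biUnion.2 ⟨ν, mem_univ _, by simpa using h⟩)
      rw [this, smul_zero]
  have hout : ∑ j ∈ Sᶜ, W j ≤ ε := by
    have e1 : ∑ j, (tensor (fun _ : Fin l => CFC.sqrt ρ) * (∑ ν, x ν • A ν j) *
        tensor (fun _ : Fin l => CFC.sqrt ρ) *
        (if j ∈ S then 0 else 1)).trace.re = 0 := sum_eq_zero fun j _ => by
      split_ifs with h
      · simp
      · simp [hzero j h]
    rw [e1, zero_add] at htest
    refine le_trans (le_of_eq ?_) htest
    rw [← sum_subset (subset_univ Sᶜ)]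
    · refine sum_congr rfl fun j hj => ?_
      rw [if_neg (mem_compl.1 hj), mul_one, htrace]
    · intro j _ hj
      rw [if_pos (by simpa using hj)]; simp
  have hin : ∑ j ∈ S, W j ≤ M * N * τ + Fintype.card J * (4 / Real.log 2 ^ 2) / c ^ 2 := by
    rw [← sum_filter_not_add_sum_filter S (fun j => τ < W j)]
    gcongr
    · calc _ ≤ ∑ j ∈ S with ¬ τ < W j, τ := sum_le_sum fun j hj => not_lt.1 (mem_filter.1 hj).2
        _ ≤ S.card * τ := by
          rw [sum_const, nsmul_eq_mul]; gcongr; exact filter_subset _ _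
        _ ≤ _ := by gcongr
    · calc _ ≤ ∑ j with τ < W j, W j :=
            sum_le_sum_of_subset_of_nonneg (filter_subset_filter _ (subset_univ _))
              fun j _ _ => prod_nonneg fun k _ => hlam0 _
        _ ≤ _ := by
          have h := sum_prod_large_le hlam0 hlam1 (fun j hj => (hlam0 j).lt_of_ne' hj) hc
            (sum_mul_logb_sq_le hlam0 hlam1.le) l
          simpa only [hτ, hW, shannonEntropy, mul_neg] using h
  have htot : ∑ j ∈ S, W j + ∑ j ∈ Sᶜ, W j = 1 := by
    rw [sum_add_sum_compl]; exact sum_prod_words hlam1 l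
  linarith

/-- The conditionally typical projectors of the states `ρ̂_{j₁} ⊗ ⋯ ⊗ ρ̂_{j_l}` detect the
post-measurement states of the product measurement with high probability. For a POVM with at most
`M` operators, all of whose post-measurement states are dominated by `ρ^{⊗l}`, which is
nearly flat, the same test succeeds with probability at most about `M` times a typical eigenvalue of
`ρ^{⊗l}` times the rank of the projectors. -/
lemma converse_rate (hρ : IsState ρ) (ha : IsPOVM a) {l N M : ℕ} {ε c : ℝ} {x : Fin N → ℝ}
    {A : Fin N → (Fin l → J) → Matrix (Fin l → n) (Fin l → n) ℂ}
    (hx : ∀ ν, 0 < x ν) (hx1 : ∑ ν, x ν = 1) (hA : ∀ ν, IsPOVM (A ν))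
    (hM : ∀ ν, {j | A ν j ≠ 0}.ncard ≤ M) (hCM : CondCM ρ a (fun j => ∑ ν, x ν • A ν j) ε)
    (hc : 0 < c) :
    1 - ε - 3 * (Fintype.card n * (4 / Real.log 2 ^ 2) / c ^ 2) ≤
      2 * (M * (2 : ℝ) ^ (-(l * mutualInfo ρ a) + 2 * c * √l)) := by
  classical
  choose V p hV hV' hp hp1 hpl hd hent using exists_postState_eq hρ ha
  obtain ⟨U, r, hU, hU', hr, hρd, hsd, hentρ⟩ := exists_eq_conjDiag hρ.1
  set lam := outcomeProb ρ a with hlam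
  have hlam0 : ∀ j, 0 ≤ lam j := outcomeProb_nonneg hρ ha
  have hlam1 : ∑ j, lam j = 1 := sum_outcomeProb hρ ha
  have hr1 : ∑ i, r i = 1 := by
    rw [← trace_conjDiag hU, ← hρd, hρ.2, Complex.one_re]
  set δ := Fintype.card n * (4 / Real.log 2 ^ 2) / c ^ 2 with hδ
  set h := ∑ j, lam j * vonNeumannEntropy (postState ρ a j) with hh
  set τ := (2 : ℝ) ^ (-(l * vonNeumannEntropy ρ) + c * √l) with hτ
  set κ := (2 : ℝ) ^ (-(l * h) - c * √l) with hκ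
  have hκ0 : 0 < κ := by positivity
  -- the joint distribution of outcomes and eigenvectors of the post-measurement states
  set P : J × n → ℝ := fun y => lam y.1 * p y.1 y.2 with hP
  have hP0 (y) : 0 ≤ P y := mul_nonneg (hlam0 _) (hp _ _)
  have hP1 : ∑ y, P y = 1 := by
    rw [Fintype.sum_prod_type]; simp only [hP, hpl, hlam1]
  have hPh : ∑ y, P y * -Real.logb 2 (p y.1 y.2) = h := by
    rw [Fintype.sum_prod_type, hh]
    refine sum_congr rfl fun j _ => ?_
    rw [hent, mul_sum]
    exact sum_congr rfl fun i _ => by simp only [hP]; ring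
  have hPV : ∑ y, P y * Real.logb 2 (p y.1 y.2) ^ 2 ≤ Fintype.card n * (4 / Real.log 2 ^ 2) := by
    rw [Fintype.sum_prod_type]
    calc _ = ∑ j, lam j * ∑ i, p j i * Real.logb 2 (p j i) ^ 2 := by
          refine sum_congr rfl fun j _ => ?_
          rw [mul_sum]
          exact sum_congr rfl fun i _ => by simp only [hP]; ring
      _ ≤ ∑ j, lam j * (Fintype.card n * (4 / Real.log 2 ^ 2)) := sum_le_sum fun j _ =>
          mul_le_mul_of_nonneg_left (sum_mul_logb_sq_le (hp j) (hp1 j)) (hlam0 j)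
      _ = _ := by rw [← sum_mul, hlam1, one_mul]
  have hsmall := sum_prod_small_le (q := fun y : J × n => p y.1 y.2) hP0 hP1
    (fun y hy => (hp _ _).lt_of_ne' (right_ne_zero_of_mul hy)) hc hPV l
  rw [hPh, ← hκ, ← hδ] at hsmall
  -- the typical projector of `ρ^{⊗l}` splits the square root into `R₁ + R₂`
  have hlarge := sum_prod_large_le hr hr1 (fun i hi => (hr i).lt_of_ne' hi) hc
    (sum_mul_logb_sq_le hr hr1.le) l
  rw [← hentρ, ← hτ, ← hδ] at hlarge
  have hTU := tensor_conjTranspose_mul fun _ : Fin l => hU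
  set R₁ := conjDiag (tensor fun _ : Fin l => U)
    (fun s => if τ < ∏ k, r (s k) then 0 else ∏ k, √(r (s k))) with hR₁
  set R₂ := conjDiag (tensor fun _ : Fin l => U)
    (fun s => if τ < ∏ k, r (s k) then ∏ k, √(r (s k)) else 0) with hR₂
  have hR : tensor (fun _ : Fin l => CFC.sqrt ρ) = R₁ + R₂ := by
    rw [hsd, tensor_conjDiag, hR₁, hR₂, conjDiag_add]
    congr 1; ext s; split_ifs <;> simp
  have hsq (s : Fin l → n) : (∏ k, √(r (s k))) * ∏ k, √(r (s k)) = ∏ k, r (s k) := by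
    rw [← prod_mul_distrib]; exact prod_congr rfl fun k _ => Real.mul_self_sqrt (hr _)
  have hR₁sq : R₁ * R₁ ≤ τ • (1 : Matrix (Fin l → n) (Fin l → n) ℂ) := by
    rw [hR₁, conjDiag_mul hTU, ← conjDiag_one (tensor_mul_conjTranspose fun _ : Fin l => hU'),
      smul_conjDiag]
    refine conjDiag_mono _ fun s => ?_
    split_ifs with hs
    · simp only [mul_zero, mul_one]; positivity
    · rw [hsq, mul_one]; exact not_lt.1 hs
  have hR₂sq : (R₂ * R₂).trace.re ≤ δ := by
    rw [hR₂, conjDiag_mul hTU, trace_conjDiag hTU]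
    refine le_trans (le_of_eq ?_) hlarge
    rw [sum_filter]
    refine sum_congr rfl fun s _ => ?_
    split_ifs
    · exact hsq s
    · simp
  -- the conditionally typical projectors
  set Q : (Fin l → J) → Matrix (Fin l → n) (Fin l → n) ℂ := fun j =>
    conjDiag (tensor fun k => V (j k))
      (fun s => if ∏ k, p (j k) (s k) < κ then 0 else 1) with hQ
  have hTV (j : Fin l → J) := tensor_conjTranspose_mul fun k => hV (j k)
  have hQ0 (j) : 0 ≤ Q j := conjDiag_nonneg _ fun s => by split_ifs <;> norm_num
  have hQ1 (j) : Q j ≤ 1 := by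
    rw [← conjDiag_one (tensor_mul_conjTranspose fun k => hV' (j k))]
    exact conjDiag_mono _ fun s => by split_ifs <;> norm_num
  have hQtr (j) : (Q j).trace.re ≤ κ⁻¹ := by
    simp only [hQ]
    rw [trace_conjDiag (hTV j)]
    calc _ ≤ ∑ s : Fin l → n, κ⁻¹ * ∏ k, p (j k) (s k) := sum_le_sum fun s _ => by
            have h0 : 0 ≤ ∏ k, p (j k) (s k) := prod_nonneg fun k _ => hp _ _
            split_ifs with hs
            · positivity
            · rw [inv_mul_eq_div, one_le_div hκ0]; exact not_lt.1 hs
      _ = κ⁻¹ * ∏ k, ∑ i, p (j k) i := by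
            rw [← mul_sum, prod_univ_sum, Fintype.piFinset_univ]
      _ ≤ κ⁻¹ * 1 := by
            gcongr
            exact prod_le_one (fun k _ => sum_nonneg fun i _ => hp _ _) fun k _ => hp1 _
      _ = κ⁻¹ := mul_one _
  have hdetect : 1 - δ ≤
      ∑ j, (tensor (fun k => CFC.sqrt ρ * a (j k) * CFC.sqrt ρ) * Q j).trace.re := by
    have e (j : Fin l → J) :
        (tensor (fun k => CFC.sqrt ρ * a (j k) * CFC.sqrt ρ) * Q j).trace.re =
        ∑ s : Fin l → n, if ∏ k, p (j k) (s k) < κ then 0 else ∏ k, P (j k, s k) := by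
      simp only [hd, hQ]
      rw [tensor_conjDiag, conjDiag_mul (hTV j), trace_conjDiag (hTV j)]
      refine sum_congr rfl fun s _ => ?_
      split_ifs <;> simp [hP]
    simp only [e]
    have e2 : ∑ j : Fin l → J, ∑ s : Fin l → n,
        (if ∏ k, p (j k) (s k) < κ then 0 else ∏ k, P (j k, s k)) =
        ∑ w : Fin l → J × n, if ∏ k, p (w k).1 (w k).2 < κ then 0 else ∏ k, P (w k) := by
      rw [← Fintype.sum_prod_type',
        ← (Equiv.arrowProdEquivProdArrow (Fin l) (fun _ => J) (fun _ => n)).sum_comp]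
      rfl
    have hone := sum_prod_words hP1 l
    rw [← sum_filter_add_sum_filter_not _ (fun w => ∏ k, p (w k).1 (w k).2 < κ)] at hone
    rw [e2, ← sum_filter_not_add_sum_filter _ (fun w => ∏ k, p (w k).1 (w k).2 < κ),
      sum_congr rfl fun w hw => if_neg (mem_filter.1 hw).2,
      sum_eq_zero (s := filter _ _) fun w hw => if_pos (mem_filter.1 hw).2]
    linarith
  have htest := sum_trace_tensor_le ha (isPOVM_convex hx hx1 hA) hCM hQ0 hQ1
  rw [hR] at htest
  have hbound : ∑ j, ((R₁ + R₂) * (∑ ν, x ν • A ν j) * (R₁ + R₂) * Q j).trace.re ≤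
      2 * (M * (τ * κ⁻¹)) + 2 * δ := by
    calc _ = ∑ ν, x ν * ∑ j, ((R₁ + R₂) * A ν j * (R₁ + R₂) * Q j).trace.re := by
          simp only [mul_sum]
          rw [sum_comm]
          refine sum_congr rfl fun j _ => ?_
          simp only [sum_mul, Matrix.trace_sum, Complex.re_sum, mul_smul_comm,
            smul_mul_assoc, Matrix.trace_smul, Complex.smul_re, smul_eq_mul]
      _ ≤ ∑ ν, x ν * (2 * (M * (τ * κ⁻¹)) + 2 * δ) := by
          refine sum_le_sum fun ν _ => mul_le_mul_of_nonneg_left ?_ (hx ν).le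
          have := sum_trace_compress_le (R₂ := R₂) (hA ν) (hM ν) (conjDiag_isHermitian _ _)
            (conjDiag_isHermitian _ _) hR₁sq (by positivity) (by positivity) hQ0 hQ1 hQtr
          linarith
      _ = _ := by rw [← sum_mul, hx1, one_mul]
  have hexp : τ * κ⁻¹ = (2 : ℝ) ^ (-(l * mutualInfo ρ a) + 2 * c * √l) := by
    rw [hτ, hκ, ← Real.rpow_neg two_pos.le, ← Real.rpow_add two_pos, mutualInfo, ← hlam, ← hh]
    congr 1; ring
  rw [← hexp]
  linarith

end Converse

lemma le_of_div_sq {V δ : ℝ} (hV : 0 ≤ V) (hδ : 0 < δ) : V / (V / δ + 1) ^ 2 ≤ δ := by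
  have h : 0 ≤ V / δ := by positivity
  rw [div_le_iff₀ (by positivity)]
  have : V = δ * (V / δ) := by field_simp
  nlinarith

lemma mul_rpow_le_of_le_mul_rpow {b M t u : ℝ} (h : b ≤ M * (2 : ℝ) ^ (-t + u)) :
    b * (2 : ℝ) ^ (t - u) ≤ M := by
  have : t - u = -(-t + u) := by ring
  rw [this, Real.rpow_neg two_pos.le, ← div_eq_mul_inv]
  exact (div_le_iff₀ (by positivity)).2 h

end QMeas

theorem theorem4 (m : ℕ) (ε : ℝ) (hε : ε < 1) :
    ∃ C₂ : ℝ, ∀ d : ℕ, ∃ C₁ : ℝ,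
      ∀ (ρ : Matrix (Fin d) (Fin d) ℂ) (a : Fin m → Matrix (Fin d) (Fin d) ℂ),
        QMeas.IsState ρ → QMeas.IsPOVM a →
      ∀ (l N M : ℕ) (x : Fin N → ℝ)
        (A : Fin N → (Fin l → Fin m) → Matrix (Fin l → Fin d) (Fin l → Fin d) ℂ),
        (∀ ν, 0 < x ν) → ∑ ν, x ν = 1 →
        (∀ ν, QMeas.IsPOVM (A ν)) →
        (∀ ν, {j | A ν j ≠ 0}.ncard ≤ M) →
        QMeas.CondCM ρ a (fun j => ∑ ν, x ν • A ν j) ε →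
        (2 : ℝ) ^ (l * QMeas.mutualInfo ρ a - C₁ * √l) ≤ M ∧
        (2 : ℝ) ^ (l * QMeas.shannonEntropy (QMeas.outcomeProb ρ a) - C₂ * √l) ≤ M * N := by
  -- `c k` makes the Chebyshev bound for alphabets of size `k` at most `(1 - ε) / 6`
  set c : ℕ → ℝ := fun k => k * (4 / Real.log 2 ^ 2) / ((1 - ε) / 6) + 1 with hc
  have hε' : 0 < (1 - ε) / 6 := by linarith
  have hc0 (k : ℕ) : 0 < c k := by positivity
  have hcheb (k : ℕ) : k * (4 / Real.log 2 ^ 2) / c k ^ 2 ≤ (1 - ε) / 6 :=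
    QMeas.le_of_div_sq (by positivity) hε'
  have hb : 0 < (1 - ε) / 4 := by linarith
  refine ⟨c m + |Real.logb 2 ((1 - ε) / 4)|, fun d =>
    ⟨2 * c d + |Real.logb 2 ((1 - ε) / 4)|, fun ρ a hρ ha l N M x A hx hx1 hA hM hCM => ⟨?_, ?_⟩⟩⟩
  · have h := QMeas.converse_rate hρ ha hx hx1 hA hM hCM (hc0 d)
    rw [Fintype.card_fin] at h
    refine QMeas.rpow_le_of_mul_rpow_le hb (QMeas.mul_rpow_le_of_le_mul_rpow ?_)
    linarith [hcheb d]
  · have h := QMeas.converse_total hρ ha hx hx1 hA hM hCM (hc0 m)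
    rw [Fintype.card_fin] at h
    have := QMeas.rpow_le_of_mul_rpow_le (n := M * N) hb
      (QMeas.mul_rpow_le_of_le_mul_rpow (t := l * QMeas.shannonEntropy (QMeas.outcomeProb ρ a))
        (u := c m * √l) (M := ((M * N : ℕ) : ℝ)) (by push_cast; linarith [hcheb m]))
    exact_mod_cast this
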